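/- Let $N\ge 1$, let $s\in(0,1)$, and let $\Omega\subseteq\mathbb{R}^N$ be a bounded open set with $C^1$ boundary. All functions are real-valued, and $$c_{N,s}:=\Big(\int_{\mathbb{R}^N}\frac{1-\cos(\zeta_1)}{|\zeta|^{N+2s}}\,d\zeta\Big)^{-1}.$$ For $f\in L^2(\Omega)$, a weak solution of the problem $$-\Delta u+(-\Delta)^s u=f\ \text{ in }\Omega,\qquad u=0\ \text{ in }\mathbb{R}^N\setminus\Omega,$$ is a function $u\in H^1(\mathbb{R}^N)$ with $u=0$ a.e. in $\mathbb{R}^N\setminus\Omega$ such that, for every $\varphi\in C_0^\infty(\Omega,\mathbb{R})$, $$\int_\Omega\langle\nabla u,\nabla\varphi\rangle\,dx+\frac{c_{N,s}}{2}\int_{\mathbb{R}^N\times\mathbb{R}^N}\frac{(u(x)-u(y))(\varphi(x)-\varphi(y))}{|x-y|^{N+2s}}\,dx\,dy=\int_\Omega f\varphi\,dx .$$ **Theorem.** For every $f\in L^2(\Omega)$ this problem has a unique weak solution $u_f\in H^1(\mathbb{R}^N)$. Furthermore, there is a constant $\mathbf c>0$, independent of $f$, such that $$\|u_f\|_{H^1(\mathbb{R}^N)}\le\mathbf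 c\,\|f\|_{L^2(\Omega)}\qquad\text{for all } f\in L^2(\Omega),$$ where $\|u\|_{H^1(\mathbb{R}^N)}=\big(\|u\|_{L^2(\mathbb{R}^N)}^2+\|\nabla u\|_{L^2(\mathbb{R}^N)}^2\big)^{1/2}$. -/

import Mathlib

open MeasureTheory Set
open scoped ContDiff Gradient

noncomputable section

namespace MixedOperator

/-- Euclidean space `ℝ^N`, with the Euclidean norm and Lebesgue measure. -/
abbrev E (N : ℕ) : Type := EuclideanSpace ℝ (Fin N)

/-- `Ω` has `C^1` boundary: near each of its boundary points `x₀`, and for some unit vector `e`,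
the set `Ω` is the strict epigraph, in the direction `e`, of a real-valued `C^1` function `γ`
defined on the hyperplane `e^⊥`. -/
def HasC1Boundary {N : ℕ} (Ω : Set (E N)) : Prop :=
  ∀ x₀ ∈ frontier Ω, ∃ r : ℝ, 0 < r ∧ ∃ e : E N, ‖e‖ = 1 ∧
    ∃ γ : ((Submodule.span ℝ {e})ᗮ : Submodule ℝ (E N)) → ℝ, ContDiff ℝ 1 γ ∧
      ∀ x ∈ Metric.ball x₀ r,
        (x ∈ Ω ↔ γ ((Submodule.span ℝ {e})ᗮ.orthogonalProjectionOnto x) < inner ℝ e x)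

/-- `φ ∈ C_0^∞(Ω, ℝ)`: smooth functions on `ℝ^N` with compact support contained in `Ω`. -/
structure IsTestFunction {N : ℕ} (Ω : Set (E N)) (φ : E N → ℝ) : Prop where
  smooth : ContDiff ℝ ∞ φ
  hasCompactSupport : HasCompactSupport φ
  tsupport_subset : tsupport φ ⊆ Ω

/-- The real space `L^2(Ω)`, with respect to Lebesgue measure on `Ω`. -/
abbrev L2 {N : ℕ} (Ω : Set (E N)) : Type := Lp ℝ 2 ((volume : Measure (E N)).restrict Ω)

/-- The real space `L^2(ℝ^N)`. -/
abbrev L2Space (N : ℕ) : Type := Lp ℝ 2 (volume : Measure (E N))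

/-- The space `L^2(ℝ^N; ℝ^N)` of vector fields. -/
abbrev L2Field (N : ℕ) : Type := Lp (E N) 2 (volume : Measure (E N))

/-- `G` is the weak gradient of `u` on `ℝ^N`. -/
def IsWeakGradient {N : ℕ} (u : L2Space N) (G : L2Field N) : Prop :=
  ∀ φ : E N → ℝ, IsTestFunction univ φ → ∀ i : Fin N,
    ∫ x, u x * fderiv ℝ φ x (EuclideanSpace.single i 1) = - ∫ x, G x i * φ x

/-- `u ∈ H^1(ℝ^N)`: the function `u ∈ L^2(ℝ^N)` has a weak gradient in `L^2`. -/
def MemH1 {N : ℕ} (u : L2Space N) : Prop := ∃ G : L2Field N, IsWeakGradient u G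

open Classical in
/-- The weak gradient `∇u` of `u ∈ H^1(ℝ^N)` (and `0` if `u` is not in `H^1(ℝ^N)`). -/
def weakGrad {N : ℕ} (u : L2Space N) : L2Field N :=
  if h : MemH1 u then h.choose else 0

theorem isWeakGradient_weakGrad {N : ℕ} {u : L2Space N} (h : MemH1 u) :
    IsWeakGradient u (weakGrad u) := by
  rw [weakGrad, dif_pos h]
  exact h.choose_spec

/-- A weak gradient is unique. -/
theorem IsWeakGradient.eq {N : ℕ} {u : L2Space N} {G H : L2Field N}
    (hG : IsWeakGradient u G) (hH : IsWeakGradient u H) : G = H := by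
  have hloc : ∀ (F : L2Field N) (i : Fin N),
      LocallyIntegrable (fun x => F x i) (volume : Measure (E N)) := by
    intro F i
    have h1 : MemLp (fun x => F x i) 2 (volume : Measure (E N)) :=
      (EuclideanSpace.proj (𝕜 := ℝ) i).comp_memLp' (Lp.memLp F)
    exact h1.locallyIntegrable (by norm_num)
  have key : ∀ i : Fin N, ∀ᵐ x ∂(volume : Measure (E N)), G x i = H x i := by
    intro i
    refine ae_eq_of_integral_contDiff_smul_eq (hloc G i) (hloc H i) ?_
    intro g hg hgs
    have ht : IsTestFunction univ g := ⟨hg, hgs, subset_univ _⟩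
    have h := (hG g ht i).symm.trans (hH g ht i)
    simp only [smul_eq_mul]
    simp only [neg_inj] at h
    simpa only [mul_comm] using h
  apply Lp.ext
  filter_upwards [ae_all_iff.2 key] with x hx
  ext i
  exact hx i

/-- The norm `‖u‖_{H^1(ℝ^N)} = (‖u‖_{L^2}^2 + ‖∇u‖_{L^2}^2)^{1/2}` of `u ∈ H^1(ℝ^N)`. -/
def h1Norm {N : ℕ} (u : L2Space N) : ℝ := Real.sqrt (‖u‖ ^ 2 + ‖weakGrad u‖ ^ 2)

/-- `u ∈ 𝕏(Ω)`: `u ∈ H^1(ℝ^N)` and `u = 0` almost everywhere in `ℝ^N ∖ Ω`. -/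
def MemX {N : ℕ} (Ω : Set (E N)) (u : L2Space N) : Prop :=
  MemH1 u ∧ ∀ᵐ x ∂(volume : Measure (E N)), x ∉ Ω → u x = 0

/-- The normalizing constant `c_{N,s}` of the fractional Laplacian `(-Δ)^s` on `ℝ^N`. -/
def fracConst (N : ℕ) [NeZero N] (s : ℝ) : ℝ :=
  (∫ ζ : E N, (1 - Real.cos (ζ 0)) / ‖ζ‖ ^ ((N : ℝ) + 2 * s))⁻¹

/-- The bilinear form of `-Δ + (-Δ)^s`, with the local part taken over `Ω`. For `0 < s < 1`,
`u ∈ H^1(ℝ^N)` and a test function `φ`, both integrands are integrable, because `H^1(ℝ^N)` embeds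
into `H^s(ℝ^N)`. -/
def mixedForm {N : ℕ} [NeZero N] (s : ℝ) (Ω : Set (E N)) (u : L2Space N) (φ : E N → ℝ) : ℝ :=
  (∫ x in Ω, inner ℝ (weakGrad u x) (∇ φ x)) +
    fracConst N s / 2 *
      ∫ p : E N × E N,
        (u p.1 - u p.2) * (φ p.1 - φ p.2) / ‖p.1 - p.2‖ ^ ((N : ℝ) + 2 * s)

/-- `u ∈ H^1(ℝ^N)` is a weak solution of the equation `-Δu + (-Δ)^s u = f` in `Ω`. -/
def IsWeakSolutionEq {N : ℕ} [NeZero N] (s : ℝ) (Ω : Set (E N)) (f : L2 Ω) (u : L2Space N) :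
    Prop :=
  MemH1 u ∧ ∀ φ : E N → ℝ, IsTestFunction Ω φ → mixedForm s Ω u φ = ∫ x in Ω, f x * φ x

/-- `u` is a weak solution of the problem `-Δu + (-Δ)^s u = f` in `Ω`, `u = 0` in `ℝ^N ∖ Ω`. -/
def IsWeakSolution {N : ℕ} [NeZero N] (s : ℝ) (Ω : Set (E N)) (f : L2 Ω) (u : L2Space N) :
    Prop :=
  IsWeakSolutionEq s Ω f u ∧ MemX Ω u

end MixedOperator

end

/-!
The proof is the variational one. A function `u` of `H^1(ℝ^N)` is represented by the pair
`(u, ∇u)` in the Hilbert space `L^2(ℝ^N) × L^2(ℝ^N; ℝ^N)`, and `H^1_0(Ω)` (`H10`) is the closure of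
the pairs `(φ, ∇φ)` with `φ ∈ C_0^∞(Ω)`. On `H^1_0(Ω)` everything rests on the estimate
`‖u(· + h) - u‖ ≤ |h| ‖∇u‖` in `L^2` (`eLpNorm_translate_sub_le`), which passes from test functions
to their limits:

* a translation by more than the diameter of `Ω` separates the supports of `u` and of its
  translate, whence the Poincaré inequality (`exists_poincare`);
* integrated against `|h|^{-N-2s}`, it bounds the Gagliardo seminorm by the `H^1` norm
  (`exists_eLpNorm_fracQuotient_le`), so that the form of `-Δ + (-Δ)^s` is continuous on
  `H^1_0(Ω)`. As `c_{N,s} ≥ 0`, the nonlocal part is nonnegative on the diagonal, and the form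
  controls `‖∇u‖^2`; by the Poincaré inequality it is coercive.

The Lax–Milgram theorem then gives exactly one solution in `H^1_0(Ω)`, and testing with the
solution itself gives the estimate by `‖f‖`.

The regularity of the boundary serves to show that every `u ∈ H^1(ℝ^N)` vanishing off `Ω` lies in
`H^1_0(Ω)` (`toLp_mem_H10_of_isWeakGradient`), so that uniqueness holds among all weak solutions.
A partition of unity reduces this to functions supported near one point of the closure of `Ω`. Such
a function is convolved with a bump centred at a small vector `v` which moves its support into `Ω`:
near a boundary point, `Ω` is an epigraph, and `v` points upwards. Convolution commutes with the
weak gradient (`gradient_convolution`), and it converges in `L^2` because translations are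
continuous there (`eLpNorm_convolution_sub_le`). -/

noncomputable section

namespace MixedOperator

open scoped ENNReal Convolution Pointwise

variable {N : ℕ}

/-! ### Averages in `L^2` and translations -/

section Average

variable {X H F : Type*} [MeasurableSpace X] [MeasurableSpace H] [NormedAddCommGroup F]

theorem eLpNorm_two_sq (μ : Measure X) (f : X → F) :
    eLpNorm f 2 μ ^ 2 = ∫⁻ x, ‖f x‖ₑ ^ 2 ∂μ := by
  have h := eLpNorm_nnreal_pow_eq_lintegral (f := f) (μ := μ) (p := 2) (by norm_num)
  simpa using h

theorem eLpNorm_two_le_iff (μ : Measure X) (f : X → F) (C : ℝ≥0∞) :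
    eLpNorm f 2 μ ≤ C ↔ ∫⁻ x, ‖f x‖ₑ ^ 2 ∂μ ≤ C ^ 2 := by
  rw [← eLpNorm_two_sq]
  exact (ENNReal.pow_le_pow_left_iff two_ne_zero).symm

theorem sq_lintegral_le (ν : Measure H) [IsProbabilityMeasure ν] {f : H → ℝ≥0∞}
    (hf : AEMeasurable f ν) : (∫⁻ h, f h ∂ν) ^ 2 ≤ ∫⁻ h, f h ^ 2 ∂ν := by
  have h := eLpNorm_le_eLpNorm_of_exponent_le (μ := ν) (f := f) (p := 1) (q := 2) (by norm_num)
    hf.aestronglyMeasurable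
  have h2 := pow_le_pow_left' h 2
  rw [eLpNorm_one_eq_lintegral_enorm] at h2
  have h3 := eLpNorm_nnreal_pow_eq_lintegral (f := f) (μ := ν) (p := 2) (by norm_num)
  simp only [enorm_eq_self, NNReal.coe_ofNat, ENNReal.coe_ofNat, ENNReal.rpow_ofNat] at h2 h3
  exact h2.trans h3.le

/-- Minkowski's integral inequality in `L^2`, for averages over a probability space: the norm of
an average is at most a common bound for the norms of the functions averaged. -/
theorem eLpNorm_average_le [NormedSpace ℝ F] {μ : Measure X} {ν : Measure H} [SFinite μ]
    [IsProbabilityMeasure ν] {f : X → H → F}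
    (hf : AEStronglyMeasurable (Function.uncurry f) (μ.prod ν)) {C : ℝ≥0∞}
    (hC : ∀ᵐ h ∂ν, eLpNorm (fun x => f x h) 2 μ ≤ C) :
    eLpNorm (fun x => ∫ h, f x h ∂ν) 2 μ ≤ C := by
  rw [eLpNorm_two_le_iff]
  calc ∫⁻ x, ‖∫ h, f x h ∂ν‖ₑ ^ 2 ∂μ
      ≤ ∫⁻ x, ∫⁻ h, ‖f x h‖ₑ ^ 2 ∂ν ∂μ := by
        refine lintegral_mono_ae ?_
        filter_upwards [hf.prodMk_left] with x hx
        refine le_trans (pow_le_pow_left' (enorm_integral_le_lintegral_enorm _) 2) ?_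
        exact sq_lintegral_le ν hx.enorm
    _ = ∫⁻ h, ∫⁻ x, ‖f x h‖ₑ ^ 2 ∂μ ∂ν := by
        exact lintegral_lintegral_swap (hf.enorm.pow_const 2)
    _ ≤ ∫⁻ _, C ^ 2 ∂ν := by
        refine lintegral_mono_ae ?_
        filter_upwards [hC] with h hh
        exact (eLpNorm_two_le_iff _ _ _).1 hh
    _ = C ^ 2 := by simp

end Average

theorem enorm_gradient {N : ℕ} (φ : E N → ℝ) (x : E N) : ‖∇ φ x‖ₑ = ‖fderiv ℝ φ x‖ₑ := by
  simp [gradient]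

/-- Translating a `C^1` function by `h` moves it in `L^2` by at most `‖h‖` times the norm of its
gradient: its increment is the average over `t ∈ (0, 1)` of its derivative at `x + t h`. -/
theorem eLpNorm_translate_sub_le_of_contDiff {N : ℕ} {φ : E N → ℝ} (hφ : ContDiff ℝ 1 φ)
    (h : E N) :
    eLpNorm (fun x => φ (x + h) - φ x) 2 volume ≤ ‖h‖ₑ * eLpNorm (∇ φ) 2 volume := by
  have hc : Continuous (fderiv ℝ φ) := hφ.continuous_fderiv one_ne_zero
  have hd : Differentiable ℝ φ := hφ.differentiable one_ne_zero
  have : IsProbabilityMeasure (volume.restrict (Ioc (0 : ℝ) 1)) := ⟨by simp⟩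
  have hcont : Continuous fun p : E N × ℝ => fderiv ℝ φ (p.1 + p.2 • h) h := by fun_prop
  have hFTC : (fun x => φ (x + h) - φ x) =
      fun x => ∫ t, fderiv ℝ φ (x + t • h) h ∂(volume.restrict (Ioc (0 : ℝ) 1)) := by
    ext x
    rw [← intervalIntegral.integral_of_le zero_le_one]
    have hder : ∀ t ∈ uIcc (0 : ℝ) 1,
        HasDerivAt (fun t : ℝ => φ (x + t • h)) (fderiv ℝ φ (x + t • h) h) t := by
      intro t _
      have h1 : HasDerivAt (fun t : ℝ => x + t • h) h t := by
        simpa using ((hasDerivAt_id t).smul_const h).const_add x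
      exact (hd (x + t • h)).hasFDerivAt.comp_hasDerivAt t h1
    rw [intervalIntegral.integral_eq_sub_of_hasDerivAt hder]
    · simp
    · exact Continuous.intervalIntegrable
        (hcont.comp (by fun_prop : Continuous fun t : ℝ => (x, t))) _ _
  rw [hFTC]
  refine eLpNorm_average_le hcont.aestronglyMeasurable (.of_forall fun t => ?_)
  have hg : Continuous (∇ φ) := by
    unfold gradient
    fun_prop
  have hmp : MeasurePreserving (fun x : E N => x + t • h) volume volume :=
    measurePreserving_add_right _ _
  rw [← eLpNorm_comp_measurePreserving hg.aestronglyMeasurable hmp]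
  refine eLpNorm_le_mul_eLpNorm_of_ae_le_mul' (c := ‖h‖₊) (.of_forall fun x => ?_) 2
  rw [Function.comp_apply, enorm_gradient, mul_comm]
  exact (fderiv ℝ φ (x + t • h)).le_opENorm h

/-- Translations act continuously on `L^2`. -/
theorem exists_eLpNorm_translate_sub_le {N : ℕ} {F : Type*} [NormedAddCommGroup F]
    {u : E N → F} (hu : MemLp u 2 volume) {ε : ℝ≥0∞} (hε : 0 < ε) :
    ∃ δ : ℝ, 0 < δ ∧ ∀ h : E N, ‖h‖ ≤ δ → eLpNorm (fun x => u (x - h) - u x) 2 volume ≤ ε := by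
  have hmp : ∀ h : E N, MeasurePreserving (fun x : E N => x - h) volume volume := fun h =>
    measurePreserving_sub_right _ h
  let g : C(E N, C(E N, E N)) :=
    (ContinuousMap.mk (fun p : E N × E N => p.2 - p.1) (by fun_prop)).curry
  have hcont : Continuous fun h : E N => Lp.compMeasurePreserving (g h) (hmp h) (hu.toLp u) :=
    continuous_const.compMeasurePreservingLp g.continuous hmp (by norm_num)
  obtain ⟨δ, hδ, h1⟩ := EMetric.continuousAt_iff.1 (hcont.continuousAt (x := 0)) ε hε
  have heq : ∀ h, Lp.compMeasurePreserving (g h) (hmp h) (hu.toLp u) =ᵐ[volume]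
      fun x => u (x - h) := fun h =>
    (Lp.coeFn_compMeasurePreserving _ (hmp h)).trans
      ((hmp h).quasiMeasurePreserving.ae_eq_comp hu.coeFn_toLp)
  have h2 : ∀ h, edist h 0 < δ → eLpNorm (fun x => u (x - h) - u x) 2 volume ≤ ε := by
    intro h hh
    refine le_trans (le_of_eq ?_) (h1 hh).le
    rw [Lp.edist_def]
    refine eLpNorm_congr_ae ?_
    filter_upwards [heq h, heq 0] with x hx hx0
    simp [hx, hx0]
  obtain ⟨δ', hδ', hlt⟩ := ENNReal.lt_iff_exists_nnreal_btwn.1 hδ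
  refine ⟨δ', by simpa using hδ', fun h hh => h2 h (lt_of_le_of_lt ?_ hlt)⟩
  rw [edist_zero_right, enorm_eq_nnnorm]
  exact_mod_cast hh

/-! ### Mollification of functions with a weak gradient -/

/-- A convolution with a probability density `η` is an average of translations, so that it is as
close to `u` in `L^2` as the translations by vectors of the support of `η` are. -/
theorem eLpNorm_convolution_sub_le {F : Type*} [NormedAddCommGroup F] [NormedSpace ℝ F]
    [CompleteSpace F] {η : E N → ℝ} (hη : Continuous η) (hηc : HasCompactSupport η)
    (hη0 : ∀ x, 0 ≤ η x) (hη1 : ∫ x, η x = 1) {u : E N → F} (hu : MemLp u 2 volume) {C : ℝ≥0∞}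
    (hC : ∀ h, η h ≠ 0 → eLpNorm (fun x => u (x - h) - u x) 2 volume ≤ C) :
    eLpNorm (fun x => (η ⋆[ContinuousLinearMap.lsmul ℝ ℝ, volume] u) x - u x) 2 volume ≤ C := by
  have hηi : Integrable η := hη.integrable_of_hasCompactSupport hηc
  have hmeas : Measurable fun h => ENNReal.ofReal (η h) := hη.measurable.ennreal_ofReal
  set ν : Measure (E N) := volume.withDensity fun h => ENNReal.ofReal (η h) with hν
  have hprob : IsProbabilityMeasure ν := by
    refine ⟨?_⟩
    rw [hν, withDensity_apply _ MeasurableSet.univ, Measure.restrict_univ,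
      ← ofReal_integral_eq_lintegral_ofReal hηi (.of_forall hη0), hη1, ENNReal.ofReal_one]
  have hint : ∀ f : E N → F, ∫ h, f h ∂ν = ∫ h, η h • f h := by
    intro f
    rw [hν, integral_withDensity_eq_integral_toReal_smul hmeas (.of_forall fun x => by simp)]
    simp [ENNReal.toReal_ofReal, hη0]
  have hex := hηc.convolutionExists_left (L := ContinuousLinearMap.lsmul ℝ ℝ) hη
    (hu.locallyIntegrable (by norm_num))
  have heq : (fun x => (η ⋆[ContinuousLinearMap.lsmul ℝ ℝ, volume] u) x - u x) =
      fun x => ∫ h, (u (x - h) - u x) ∂ν := by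
    ext x
    rw [hint]
    simp only [smul_sub]
    rw [integral_sub (by simpa using (hex x).integrable) (hηi.smul_const _),
      integral_smul_const, hη1, one_smul, convolution_def]
    simp
  rw [heq]
  have hac : ν ≪ volume := withDensity_absolutelyContinuous _ _
  refine eLpNorm_average_le (f := fun x h => u (x - h) - u x) ?_ ?_
  · have h1 : AEStronglyMeasurable (fun p : E N × E N => u (p.1 - p.2)) (volume.prod ν) :=
      hu.aestronglyMeasurable.comp_quasiMeasurePreserving
        (quasiMeasurePreserving_sub_of_right_invariant volume ν)
    exact h1.sub hu.aestronglyMeasurable.comp_fst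
  · rw [hν, ae_withDensity_iff hmeas]
    refine .of_forall fun h hh => hC h fun h0 => hh (by simp [h0])

/-- `G` is the weak gradient of the function `u`; for classes in `L^2` this is
`IsWeakGradient`. -/
def HasWeakGradient (u : E N → ℝ) (G : E N → E N) : Prop :=
  ∀ φ : E N → ℝ, IsTestFunction univ φ → ∀ i : Fin N,
    ∫ x, u x * fderiv ℝ φ x (EuclideanSpace.single i 1) = - ∫ x, G x i * φ x

theorem HasWeakGradient.congr {u u' : E N → ℝ} {G G' : E N → E N} (h : HasWeakGradient u G)
    (hu : u =ᵐ[volume] u') (hG : G =ᵐ[volume] G') : HasWeakGradient u' G' := by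
  intro φ hφ i
  have h1 : ∫ x, u' x * fderiv ℝ φ x (EuclideanSpace.single i 1) =
      ∫ x, u x * fderiv ℝ φ x (EuclideanSpace.single i 1) :=
    integral_congr_ae (by filter_upwards [hu] with x hx; rw [hx])
  have h2 : ∫ x, G' x i * φ x = ∫ x, G x i * φ x :=
    integral_congr_ae (by filter_upwards [hG] with x hx; rw [hx])
  rw [h1, h2, h φ hφ i]

theorem gradient_apply (f : E N → ℝ) (x : E N) (i : Fin N) :
    (∇ f x) i = fderiv ℝ f x (EuclideanSpace.single i 1) := by
  have h : inner ℝ (∇ f x) (EuclideanSpace.single i (1 : ℝ)) =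
      fderiv ℝ f x (EuclideanSpace.single i 1) := by
    simp [gradient]
  rw [← h, EuclideanSpace.inner_single_right]
  simp

/-- Mollification turns a weak gradient into a classical one. -/
theorem gradient_convolution {η : E N → ℝ} (hη : IsTestFunction univ η) {u : E N → ℝ}
    {G : E N → E N} (hu : LocallyIntegrable u volume) (hG : LocallyIntegrable G volume)
    (huG : HasWeakGradient u G) (x : E N) :
    ∇ (η ⋆[ContinuousLinearMap.lsmul ℝ ℝ, volume] u) x =
      (η ⋆[ContinuousLinearMap.lsmul ℝ ℝ, volume] G) x := by
  ext i
  have hc1 : ContDiff ℝ 1 η := hη.smooth.of_le (by simp)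
  rw [gradient_apply,
    (hη.hasCompactSupport.hasFDerivAt_convolution_left _ hc1 hu x).fderiv]
  have hexG : Integrable (fun t => η (x - t) • G t) := by
    have := (hη.hasCompactSupport.convolutionExists_left (L := ContinuousLinearMap.lsmul ℝ ℝ)
      hc1.continuous hG x).integrable_swap
    simpa using this
  have hexu := ((hη.hasCompactSupport.fderiv ℝ).convolutionExists_left
    (L := (ContinuousLinearMap.lsmul ℝ ℝ).precompL (E N)) (hc1.continuous_fderiv one_ne_zero)
    hu x).integrable_swap
  have hφ : IsTestFunction univ fun y => η (x - y) :=
    ⟨hη.smooth.comp (contDiff_const.sub contDiff_id),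
      hη.hasCompactSupport.comp_homeomorph (Homeomorph.subLeft x), subset_univ _⟩
  have key := huG _ hφ i
  rw [convolution_eq_swap, convolution_eq_swap, ContinuousLinearMap.integral_apply hexu]
  have h1 : ((∫ t, (ContinuousLinearMap.lsmul ℝ ℝ) (η (x - t)) (G t)) : E N) i =
      ∫ t, G t i * η (x - t) := by
    have := (EuclideanSpace.proj (𝕜 := ℝ) i).integral_comp_comm hexG
    simp only [PiLp.proj_apply, PiLp.smul_apply, smul_eq_mul] at this
    simp only [ContinuousLinearMap.lsmul_apply]
    rw [← this]
    simp only [mul_comm]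
  have h2 : ∀ t, fderiv ℝ (fun y => η (x - y)) t (EuclideanSpace.single i 1) =
      - fderiv ℝ η (x - t) (EuclideanSpace.single i 1) := by
    intro t
    have hd : HasFDerivAt (fun y => x - y) (-ContinuousLinearMap.id ℝ (E N)) t :=
      (hasFDerivAt_id t).const_sub x
    have hcomp : HasFDerivAt (fun y => η (x - y)) _ t :=
      (hc1.differentiable one_ne_zero (x - t)).hasFDerivAt.comp t hd
    rw [hcomp.fderiv]
    simp
  rw [h1, ← neg_eq_iff_eq_neg.2 key, ← integral_neg]
  refine integral_congr_ae (.of_forall fun t => ?_)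
  simp only [h2, ContinuousLinearMap.precompL_apply, ContinuousLinearMap.lsmul_apply]
  simp [mul_comm]

/-- If `u` vanishes off a compact set `K` which arbitrarily small translations move into `Ω`, then
`u` and its weak gradient are limits in `L^2` of test functions in `Ω` and their gradients. The
test function is the convolution of `u` with a bump centred at the vector of the translation. -/
theorem exists_testFunction_approx {Ω K : Set (E N)} (hΩ : IsOpen Ω) (hK : IsCompact K)
    {u : E N → ℝ} {G : E N → E N} (hu : MemLp u 2 volume) (hG : MemLp G 2 volume)
    (huG : HasWeakGradient u G) (huK : ∀ᵐ x ∂(volume : Measure (E N)), x ∉ K → u x = 0)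
    (hKΩ : ∀ δ : ℝ, 0 < δ → ∃ v : E N, ‖v‖ < δ ∧ ∀ x ∈ K, x + v ∈ Ω)
    {ε : ℝ≥0∞} (hε : 0 < ε) :
    ∃ φ : E N → ℝ, IsTestFunction Ω φ ∧ eLpNorm (fun x => φ x - u x) 2 volume ≤ ε ∧
      eLpNorm (fun x => ∇ φ x - G x) 2 volume ≤ ε := by
  obtain ⟨δ₁, hδ₁, hu'⟩ := exists_eLpNorm_translate_sub_le hu hε
  obtain ⟨δ₂, hδ₂, hG'⟩ := exists_eLpNorm_translate_sub_le hG hε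
  obtain ⟨v, hv, hvK⟩ := hKΩ (min δ₁ δ₂ / 2) (by positivity)
  have hKv : IsCompact ((fun x => x + v) '' K) := hK.image (by fun_prop)
  obtain ⟨r, hr, hrΩ⟩ := hKv.exists_cthickening_subset_open hΩ
    (by rintro _ ⟨x, hx, rfl⟩; exact hvK x hx)
  set ρ := min r (min δ₁ δ₂ / 2) with hρ
  have hρ0 : 0 < ρ := by positivity
  let b : ContDiffBump v := ⟨ρ / 2, ρ, by positivity, by linarith⟩
  set η := b.normed volume with hη_def
  have hts : tsupport η = Metric.closedBall v ρ := b.tsupport_normed_eq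
  have hη : IsTestFunction univ η := ⟨b.contDiff_normed, b.hasCompactSupport_normed, subset_univ _⟩
  have hsmall : ∀ h, η h ≠ 0 → ‖h‖ ≤ min δ₁ δ₂ := by
    intro h hh
    have h1 : h ∈ Metric.closedBall v ρ := hts ▸ subset_tsupport η hh
    rw [mem_closedBall_iff_norm] at h1
    have h2 : ‖h‖ ≤ ‖h - v‖ + ‖v‖ := by simpa using norm_add_le (h - v) v
    have h3 : ρ ≤ min δ₁ δ₂ / 2 := min_le_right _ _
    linarith
  have hnear : ∀ {F : Type} [NormedAddCommGroup F] [NormedSpace ℝ F] [CompleteSpace F]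
      {w : E N → F},
      MemLp w 2 volume → (∀ h : E N, ‖h‖ ≤ min δ₁ δ₂ →
        eLpNorm (fun x => w (x - h) - w x) 2 volume ≤ ε) →
      eLpNorm (fun x => (η ⋆[ContinuousLinearMap.lsmul ℝ ℝ, volume] w) x - w x) 2 volume ≤ ε :=
    fun hw hh => eLpNorm_convolution_sub_le hη.smooth.continuous hη.hasCompactSupport
      b.nonneg_normed b.integral_normed hw fun h h0 => hh h (hsmall h h0)
  have hul := hu.locallyIntegrable (by norm_num)
  have hGl := hG.locallyIntegrable (by norm_num)
  -- Redefining `u` off `K` as `0` does not change its convolutions.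
  have hcongr : (η ⋆[ContinuousLinearMap.lsmul ℝ ℝ, volume] u) =
      (η ⋆[ContinuousLinearMap.lsmul ℝ ℝ, volume] K.indicator u) := by
    refine convolution_congr _ .rfl ?_
    filter_upwards [huK] with x hx
    by_cases hxK : x ∈ K
    · simp [hxK]
    · simp [hxK, hx hxK]
  have hcomp : IsCompact (tsupport η + K) := hη.hasCompactSupport.isCompact.add hK
  have hsupp : tsupport (η ⋆[ContinuousLinearMap.lsmul ℝ ℝ, volume] u) ⊆ tsupport η + K := by
    refine closure_minimal ?_ hcomp.isClosed
    rw [hcongr]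
    refine (support_convolution_subset _).trans (add_subset_add (subset_tsupport _) ?_)
    exact support_indicator_subset
  refine ⟨η ⋆[ContinuousLinearMap.lsmul ℝ ℝ, volume] u, ⟨?_, ?_, ?_⟩, ?_, ?_⟩
  · exact hη.hasCompactSupport.contDiff_convolution_left _ hη.smooth hul
  · exact HasCompactSupport.of_support_subset_isCompact hcomp ((subset_tsupport _).trans hsupp)
  · refine hsupp.trans (Subset.trans ?_ hrΩ)
    rintro _ ⟨h, hh, x, hx, rfl⟩
    rw [hts, mem_closedBall_iff_norm] at hh
    refine Metric.mem_cthickening_of_dist_le _ (x + v) _ _ (mem_image_of_mem _ hx) ?_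
    rw [dist_eq_norm]
    have : h + x - (x + v) = h - v := by abel
    simp only [this]
    exact hh.trans (min_le_left _ _)
  · exact hnear hu fun h hh => hu' h (hh.trans (min_le_left _ _))
  · simp only [gradient_convolution hη hul hGl huG]
    exact hnear hG fun h hh => hG' h (hh.trans (min_le_right _ _))

/-! ### Test functions and the space `H^1_0(Ω)` -/

section TestFunction

variable {Ω : Set (E N)} {φ ψ : E N → ℝ}

theorem IsTestFunction.zero (Ω : Set (E N)) : IsTestFunction Ω (0 : E N → ℝ) :=
  ⟨contDiff_const, HasCompactSupport.zero, by simp [tsupport]⟩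

theorem IsTestFunction.add (hφ : IsTestFunction Ω φ) (hψ : IsTestFunction Ω ψ) :
    IsTestFunction Ω (φ + ψ) :=
  ⟨hφ.smooth.add hψ.smooth, hφ.hasCompactSupport.add hψ.hasCompactSupport,
    (tsupport_add φ ψ).trans (union_subset hφ.tsupport_subset hψ.tsupport_subset)⟩

theorem IsTestFunction.const_smul (c : ℝ) (hφ : IsTestFunction Ω φ) :
    IsTestFunction Ω (c • φ) :=
  ⟨hφ.smooth.const_smul c, hφ.hasCompactSupport.smul_left (f := fun _ => c),
    (tsupport_smul_subset_right (fun _ => c) φ).trans hφ.tsupport_subset⟩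

theorem IsTestFunction.mul (hψ : ContDiff ℝ ∞ ψ) (hφ : IsTestFunction Ω φ) :
    IsTestFunction Ω (ψ * φ) :=
  ⟨hψ.mul hφ.smooth, hφ.hasCompactSupport.mul_left,
    (tsupport_mul_subset_right (f := ψ)).trans hφ.tsupport_subset⟩

theorem IsTestFunction.differentiable (hφ : IsTestFunction Ω φ) : Differentiable ℝ φ :=
  hφ.smooth.differentiable (by simp)

theorem IsTestFunction.continuous_fderiv (hφ : IsTestFunction Ω φ) :
    Continuous (fderiv ℝ φ) :=
  hφ.smooth.continuous_fderiv (by simp)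

theorem IsTestFunction.continuous_gradient (hφ : IsTestFunction Ω φ) : Continuous (∇ φ) := by
  have := hφ.continuous_fderiv
  unfold gradient
  fun_prop

theorem tsupport_gradient_subset (φ : E N → ℝ) : tsupport (∇ φ) ⊆ tsupport φ := by
  refine closure_minimal ?_ (isClosed_tsupport φ)
  refine Subset.trans (fun x hx => ?_) (support_fderiv_subset ℝ (f := φ))
  intro h
  apply hx
  simp [gradient, h]

theorem IsTestFunction.hasCompactSupport_gradient (hφ : IsTestFunction Ω φ) :
    HasCompactSupport (∇ φ) :=
  hφ.hasCompactSupport.of_isClosed_subset (isClosed_tsupport _) (tsupport_gradient_subset φ)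

theorem IsTestFunction.memLp (hφ : IsTestFunction Ω φ) (p : ℝ≥0∞) : MemLp φ p volume :=
  hφ.smooth.continuous.memLp_of_hasCompactSupport hφ.hasCompactSupport

theorem IsTestFunction.memLp_gradient (hφ : IsTestFunction Ω φ) (p : ℝ≥0∞) :
    MemLp (∇ φ) p volume :=
  hφ.continuous_gradient.memLp_of_hasCompactSupport hφ.hasCompactSupport_gradient

theorem IsTestFunction.gradient_add (hφ : IsTestFunction Ω φ) (hψ : IsTestFunction Ω ψ) :
    ∇ (φ + ψ) = ∇ φ + ∇ ψ := by
  ext x : 1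
  simp [gradient, fderiv_add (hφ.differentiable x) (hψ.differentiable x)]

theorem IsTestFunction.gradient_const_smul (c : ℝ) (hφ : IsTestFunction Ω φ) :
    ∇ (c • φ) = c • ∇ φ := by
  ext x : 1
  simp [gradient, fderiv_const_smul (hφ.differentiable x) c]

/-- The classical gradient of a test function is its weak gradient. -/
theorem IsTestFunction.hasWeakGradient (hφ : IsTestFunction Ω φ) : HasWeakGradient φ (∇ φ) := by
  intro ψ hψ i
  have hi : ∀ {f : E N → ℝ}, Continuous f → HasCompactSupport f → Integrable f volume :=
    fun h h' => h.integrable_of_hasCompactSupport h'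
  have h1 := hφ.continuous_fderiv
  have h2 := hψ.continuous_fderiv
  have h3 := hφ.smooth.continuous
  have h4 := hψ.smooth.continuous
  simp only [gradient_apply]
  refine integral_mul_fderiv_eq_neg_fderiv_mul_of_integrable ?_ ?_ ?_
    (fun x _ => hφ.differentiable x) (fun x _ => hψ.differentiable x)
  · exact hi (by fun_prop) hψ.hasCompactSupport.mul_left
  · exact hi (by fun_prop) hφ.hasCompactSupport.mul_right
  · exact hi (by fun_prop) hφ.hasCompactSupport.mul_right

end TestFunction

/-- The Hilbert space of pairs of a function in `L^2(ℝ^N)` and a vector field in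
`L^2(ℝ^N; ℝ^N)`, in which a function `u ∈ H^1(ℝ^N)` is represented by `(u, ∇u)`. -/
abbrev L2Pair (N : ℕ) : Type := WithLp 2 (L2Space N × L2Field N)

/-- The pairs `(φ, ∇φ)` for `φ ∈ C_0^∞(Ω)`. -/
def testPairs (Ω : Set (E N)) : Submodule ℝ (L2Pair N) where
  carrier := {p | ∃ φ : E N → ℝ, IsTestFunction Ω φ ∧ p.fst =ᵐ[volume] φ ∧ p.snd =ᵐ[volume] ∇ φ}
  zero_mem' := by
    refine ⟨0, .zero Ω, Lp.coeFn_zero _ _ _, ?_⟩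
    refine (Lp.coeFn_zero _ _ _).trans (.of_eq ?_)
    ext x : 1
    simp [gradient]
  add_mem' := by
    rintro p q ⟨φ, hφ, hp1, hp2⟩ ⟨ψ, hψ, hq1, hq2⟩
    refine ⟨φ + ψ, hφ.add hψ, (Lp.coeFn_add _ _).trans (hp1.add hq1), ?_⟩
    rw [hφ.gradient_add hψ]
    exact (Lp.coeFn_add _ _).trans (hp2.add hq2)
  smul_mem' := by
    rintro c p ⟨φ, hφ, hp1, hp2⟩
    refine ⟨c • φ, hφ.const_smul c, (Lp.coeFn_smul _ _).trans (hp1.const_smul c), ?_⟩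
    rw [hφ.gradient_const_smul c]
    exact (Lp.coeFn_smul _ _).trans (hp2.const_smul c)

/-- The space `H^1_0(Ω)`: the closure of `C_0^∞(Ω)` in `H^1(ℝ^N)`, each `u` being represented by
the pair `(u, ∇u)`. -/
def H10 (Ω : Set (E N)) : Submodule ℝ (L2Pair N) := (testPairs Ω).topologicalClosure

/-- The element `(φ, ∇φ)` of `H^1_0(Ω)` given by a test function `φ`. -/
def IsTestFunction.toPair {Ω : Set (E N)} {φ : E N → ℝ} (hφ : IsTestFunction Ω φ) : L2Pair N :=
  WithLp.toLp 2 ((hφ.memLp 2).toLp φ, (hφ.memLp_gradient 2).toLp (∇ φ))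

theorem IsTestFunction.toPair_fst {Ω : Set (E N)} {φ : E N → ℝ} (hφ : IsTestFunction Ω φ) :
    hφ.toPair.fst =ᵐ[volume] φ :=
  (hφ.memLp 2).coeFn_toLp

theorem IsTestFunction.toPair_snd {Ω : Set (E N)} {φ : E N → ℝ} (hφ : IsTestFunction Ω φ) :
    hφ.toPair.snd =ᵐ[volume] ∇ φ :=
  (hφ.memLp_gradient 2).coeFn_toLp

theorem IsTestFunction.toPair_mem {Ω : Set (E N)} {φ : E N → ℝ} (hφ : IsTestFunction Ω φ) :
    hφ.toPair ∈ H10 Ω :=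
  (testPairs Ω).le_topologicalClosure ⟨φ, hφ, hφ.toPair_fst, hφ.toPair_snd⟩

/-- A closed property of pairs holds on `H^1_0(Ω)` if it holds for test functions. -/
theorem H10.closed_induction {Ω : Set (E N)} {P : L2Pair N → Prop} (hP : IsClosed {p | P p})
    (h : ∀ (p : L2Pair N) (φ : E N → ℝ), IsTestFunction Ω φ → p.fst =ᵐ[volume] φ →
      p.snd =ᵐ[volume] ∇ φ → P p) {p : L2Pair N} (hp : p ∈ H10 Ω) : P p :=
  have hsub : (testPairs Ω : Set (L2Pair N)) ⊆ {p | P p} :=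
    fun q ⟨φ, hφ, h1, h2⟩ => h q φ hφ h1 h2
  closure_minimal hsub hP hp

theorem continuous_integral_inner {F : Type*} [NormedAddCommGroup F] [InnerProductSpace ℝ F]
    {w : E N → F} (hw : MemLp w 2 volume) :
    Continuous fun f : Lp F 2 (volume : Measure (E N)) => ∫ x, inner ℝ (w x) (f x) := by
  have h : (fun f : Lp F 2 (volume : Measure (E N)) => ∫ x, inner ℝ (w x) (f x)) =
      fun f => inner ℝ (hw.toLp w) f := by
    ext f
    rw [L2.inner_def]
    refine integral_congr_ae ?_
    filter_upwards [hw.coeFn_toLp] with x hx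
    rw [hx]
  rw [h]
  fun_prop

/-- The relation between a function and its weak gradient is closed in `L^2`. -/
theorem isWeakGradient_of_mem_H10 {Ω : Set (E N)} {p : L2Pair N} (hp : p ∈ H10 Ω) :
    IsWeakGradient p.fst p.snd := by
  refine H10.closed_induction (P := fun p => IsWeakGradient p.fst p.snd) ?_
    (fun q φ hφ h1 h2 => ?_) hp
  · simp only [IsWeakGradient, ofPred_forall]
    refine isClosed_iInter fun φ => isClosed_iInter fun hφ => isClosed_iInter fun i => ?_
    have h1 : MemLp (fun x => fderiv ℝ φ x (EuclideanSpace.single i 1)) 2 volume := by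
      have h2 := hφ.continuous_fderiv
      refine Continuous.memLp_of_hasCompactSupport (by fun_prop) ?_
      exact hφ.hasCompactSupport.fderiv_apply (𝕜 := ℝ) _
    have h2 : MemLp (fun x => φ x • EuclideanSpace.single i (1 : ℝ)) 2 volume := by
      have h3 := hφ.smooth.continuous
      refine Continuous.memLp_of_hasCompactSupport (by fun_prop) ?_
      exact hφ.hasCompactSupport.smul_right
    have h3 := (continuous_integral_inner h1).comp
      (WithLp.continuous_fst 2 (L2Space N) (L2Field N))
    have h4 := (continuous_integral_inner h2).comp
      (WithLp.continuous_snd 2 (L2Space N) (L2Field N))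
    have h5 := isClosed_eq h3 h4.neg
    convert h5 using 4
    · exact integral_congr_ae (.of_forall fun x => by simp)
    · refine congrArg Neg.neg (integral_congr_ae (.of_forall fun x => ?_))
      simp [inner_smul_left, EuclideanSpace.inner_single_left, mul_comm]
  · exact hφ.hasWeakGradient.congr h1.symm h2.symm

theorem ae_eq_zero_of_mem_H10 {Ω : Set (E N)} (hΩ : MeasurableSet Ω) {p : L2Pair N}
    (hp : p ∈ H10 Ω) : ∀ᵐ x ∂(volume : Measure (E N)), x ∉ Ω → p.fst x = 0 := by
  -- The condition says that `p.fst` is in the kernel of the restriction to the complement of `Ω`.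
  set R := LpToLpRestrictCLM (E N) ℝ ℝ volume 2 Ωᶜ with hR
  have hRu : ∀ u : L2Space N, R u = 0 ↔ ∀ᵐ x ∂(volume : Measure (E N)), x ∉ Ω → u x = 0 := by
    intro u
    rw [Lp.eq_zero_iff_ae_eq_zero]
    simp only [← mem_compl_iff]
    rw [← ae_restrict_iff' hΩ.compl]
    have h := LpToLpRestrictCLM_coeFn ℝ (μ := volume) Ωᶜ u
    constructor
    · intro h0
      filter_upwards [h, h0] with x h1 h2
      rw [← h1, h2, Pi.zero_apply]
    · intro h0
      filter_upwards [h, h0] with x h1 h2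
      rw [h1, h2, Pi.zero_apply]
  rw [← hRu]
  refine H10.closed_induction (P := fun p => R p.fst = 0) ?_ (fun q φ hφ h1 _ => ?_) hp
  · exact isClosed_eq (R.continuous.comp (WithLp.continuous_fst 2 _ _)) continuous_const
  · rw [hRu]
    filter_upwards [h1] with x hx hxΩ
    rw [hx]
    exact image_eq_zero_of_notMem_tsupport fun h => hxΩ (hφ.tsupport_subset h)

/-! ### Density of test functions -/

/-- The product rule for the weak gradient. -/
theorem HasWeakGradient.mul {χ : E N → ℝ} (hχ : IsTestFunction univ χ) {u : E N → ℝ}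
    {G : E N → E N} (hu : LocallyIntegrable u volume) (hG : LocallyIntegrable G volume)
    (h : HasWeakGradient u G) :
    HasWeakGradient (fun x => χ x * u x) (fun x => χ x • G x + u x • ∇ χ x) := by
  intro φ hφ i
  have key := h (χ * φ) (hφ.mul hχ.smooth) i
  have hc1 := hχ.smooth.continuous
  have hc2 := hφ.smooth.continuous
  have hc3 := hχ.continuous_fderiv
  have hc4 := hφ.continuous_fderiv
  have hGi : LocallyIntegrable (fun x => G x i) volume := by
    intro x
    obtain ⟨s, hs, hsi⟩ := hG x
    exact ⟨s, hs, (EuclideanSpace.proj (𝕜 := ℝ) i).integrable_comp hsi⟩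
  have hmulu : ∀ {w : E N → ℝ}, Continuous w → HasCompactSupport w →
      Integrable (fun x => u x * w x) volume := fun hw hws => by
    simpa [mul_comm] using hu.integrable_smul_left_of_hasCompactSupport hw hws
  have hmulG : Integrable (fun x => G x i * (χ x * φ x)) volume := by
    simpa [mul_comm] using
      hGi.integrable_smul_left_of_hasCompactSupport (hc1.mul hc2) hφ.hasCompactSupport.mul_left
  have h1 : Integrable (fun x => u x * (fderiv ℝ φ x (EuclideanSpace.single i 1) * χ x)) volume :=
    hmulu (by fun_prop) hχ.hasCompactSupport.mul_left
  have h2 : Integrable (fun x => u x * (fderiv ℝ χ x (EuclideanSpace.single i 1) * φ x)) volume :=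
    hmulu (by fun_prop) hφ.hasCompactSupport.mul_left
  have e1 : ∀ x, u x * fderiv ℝ (χ * φ) x (EuclideanSpace.single i 1) =
      u x * (fderiv ℝ φ x (EuclideanSpace.single i 1) * χ x) +
        u x * (fderiv ℝ χ x (EuclideanSpace.single i 1) * φ x) := by
    intro x
    rw [fderiv_mul (hχ.differentiable x) (hφ.differentiable x)]
    simp
    ring
  have e2 : ∀ x, (χ x • G x + u x • ∇ χ x) i * φ x = G x i * (χ x * φ x) +
      u x * (fderiv ℝ χ x (EuclideanSpace.single i 1) * φ x) := by
    intro x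
    simp only [PiLp.add_apply, PiLp.smul_apply, gradient_apply, smul_eq_mul]
    ring
  simp only [e1, Pi.mul_apply] at key
  rw [integral_add h1 h2] at key
  simp only [e2]
  rw [integral_add hmulG h2, neg_add, ← key]
  have e3 : ∀ x, χ x * u x * fderiv ℝ φ x (EuclideanSpace.single i 1) =
      u x * (fderiv ℝ φ x (EuclideanSpace.single i 1) * χ x) := fun x => by ring
  simp only [e3]
  ring

/-- Membership in `H^1_0(Ω)` in terms of representatives. -/
theorem toLp_mem_H10 {Ω : Set (E N)} {u : E N → ℝ} {G : E N → E N} (hu : MemLp u 2 volume)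
    (hG : MemLp G 2 volume)
    (h : ∀ ε : ℝ≥0∞, 0 < ε → ∃ φ : E N → ℝ, IsTestFunction Ω φ ∧
      eLpNorm (fun x => φ x - u x) 2 volume ≤ ε ∧
      eLpNorm (fun x => ∇ φ x - G x) 2 volume ≤ ε) :
    (WithLp.toLp 2 (hu.toLp u, hG.toLp G) : L2Pair N) ∈ H10 Ω := by
  refine Metric.mem_closure_iff.2 fun ε hε => ?_
  obtain ⟨φ, hφ, h1, h2⟩ := h (ENNReal.ofReal (ε / 3)) (by simpa using hε)
  refine ⟨hφ.toPair, ⟨φ, hφ, hφ.toPair_fst, hφ.toPair_snd⟩, ?_⟩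
  have e1 : dist ((hu.toLp u)) hφ.toPair.fst ≤ ε / 3 := by
    rw [dist_comm, ← edist_le_ofReal (by positivity)]
    exact (Lp.edist_toLp_toLp _ _ (hφ.memLp 2) hu).trans_le h1
  have e2 : dist ((hG.toLp G)) hφ.toPair.snd ≤ ε / 3 := by
    rw [dist_comm, ← edist_le_ofReal (by positivity)]
    exact (Lp.edist_toLp_toLp _ _ (hφ.memLp_gradient 2) hG).trans_le h2
  rw [WithLp.prod_dist_eq_of_L2, WithLp.toLp_fst, WithLp.toLp_snd, Real.sqrt_lt' hε]
  have := dist_nonneg (x := hu.toLp u) (y := hφ.toPair.fst)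
  have := dist_nonneg (x := hG.toLp G) (y := hφ.toPair.snd)
  nlinarith

/-- A set with `C^1` boundary can be translated, locally at each point of its closure and by
arbitrarily small vectors, into itself: at a boundary point, in the direction in which the set is
an epigraph. -/
theorem exists_translate_mem {Ω : Set (E N)} (hΩo : IsOpen Ω) (hΩ : HasC1Boundary Ω) {x₀ : E N}
    (hx₀ : x₀ ∈ closure Ω) :
    ∃ r : ℝ, 0 < r ∧ ∀ δ : ℝ, 0 < δ → ∃ v : E N, ‖v‖ < δ ∧
      ∀ x ∈ Metric.ball x₀ r ∩ closure Ω, x + v ∈ Ω := by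
  by_cases hx : x₀ ∈ Ω
  · obtain ⟨r, hr, hrΩ⟩ := Metric.isOpen_iff.1 hΩo x₀ hx
    exact ⟨r, hr, fun δ hδ => ⟨0, by simpa using hδ, fun x hx => by simpa using hrΩ hx.1⟩⟩
  obtain ⟨r, hr, e, he, γ, hγ, hrΩ⟩ := hΩ x₀ (by rw [hΩo.frontier_eq]; exact ⟨hx₀, hx⟩)
  set P := (Submodule.span ℝ {e})ᗮ.orthogonalProjectionOnto with hP
  have hPe : P e = 0 := by
    rw [hP, Submodule.orthogonalProjectionOnto_eq_zero_iff, Submodule.orthogonal_orthogonal]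
    exact Submodule.mem_span_singleton_self e
  have hγc : Continuous γ := hγ.continuous
  refine ⟨r / 2, by positivity, fun δ hδ => ?_⟩
  set t := min δ r / 2 with ht
  have ht0 : 0 < t := by positivity
  have htδ : t < δ := by have := min_le_left δ r; linarith
  have htr : t ≤ r / 2 := by have := min_le_right δ r; linarith
  refine ⟨t • e, by rwa [norm_smul, he, mul_one, Real.norm_of_nonneg ht0.le], ?_⟩
  rintro x ⟨hxr, hxΩ⟩
  have hle : γ (P x) ≤ inner ℝ e x := by
    -- `x` is a limit of points of `Ω` in the ball, where the inequality is strict.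
    have hcl : x ∈ closure (Metric.ball x₀ r ∩ Ω) :=
      Metric.isOpen_ball.inter_closure ⟨Metric.ball_subset_ball (by linarith) hxr, hxΩ⟩
    refine closure_minimal (t := {y | γ (P y) ≤ inner ℝ e y})
      (fun y hy => ((hrΩ y hy.1).1 hy.2).le) ?_ hcl
    exact isClosed_le (by fun_prop) (by fun_prop)
  rw [hrΩ]
  · rw [map_add, map_smul, hPe, smul_zero, add_zero, inner_add_right, inner_smul_right,
      real_inner_self_eq_norm_sq, he]
    linarith
  · rw [mem_ball_iff_norm] at hxr ⊢
    have : ‖x + t • e - x₀‖ ≤ ‖x - x₀‖ + ‖t • e‖ := by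
      rw [add_sub_right_comm]
      exact norm_add_le _ _
    rw [norm_smul, he, mul_one, Real.norm_of_nonneg ht0.le] at this
    linarith

open scoped Manifold in
/-- **Density of test functions.** If `Ω` is bounded with `C^1` boundary, then `H^1_0(Ω)` consists
of all functions of `H^1(ℝ^N)` that vanish almost everywhere off `Ω`. Such a function is cut into
finitely many pieces by a partition of unity, each piece being supported where a small translation
moves it into `Ω`. -/
theorem toLp_mem_H10_of_isWeakGradient {Ω : Set (E N)} (hΩo : IsOpen Ω)
    (hΩb : Bornology.IsBounded Ω) (hΩ : HasC1Boundary Ω) {u : L2Space N} {G : L2Field N}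
    (huG : IsWeakGradient u G) (hu : ∀ᵐ x ∂(volume : Measure (E N)), x ∉ Ω → u x = 0) :
    (WithLp.toLp 2 (u, G) : L2Pair N) ∈ H10 Ω := by
  choose! r hr hv using fun x₀ (hx₀ : x₀ ∈ closure Ω) => exists_translate_mem hΩo hΩ hx₀
  obtain ⟨f, hf⟩ := SmoothPartitionOfUnity.exists_isSubordinate 𝓘(ℝ, E N)
    (isClosed_closure (s := Ω)) (fun x : closure Ω => Metric.ball (x : E N) (r x))
    (fun _ => Metric.isOpen_ball)
    (fun x hx => mem_iUnion.2 ⟨⟨x, hx⟩, Metric.mem_ball_self (hr x hx)⟩)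
  have hfin : {i | (Function.support (f i) ∩ closure Ω).Nonempty}.Finite :=
    f.locallyFinite.finite_nonempty_inter_compact hΩb.isCompact_closure
  have hum := Lp.memLp u
  have hGm := Lp.memLp G
  have hpiece : ∀ i, ∃ p ∈ H10 Ω, p.fst =ᵐ[volume] fun x => f i x * u x := by
    intro i
    have hχ : IsTestFunction univ (f i) := by
      refine ⟨(f i).contMDiff.contDiff, ?_, subset_univ _⟩
      exact (isCompact_closedBall (i : E N) (r i)).of_isClosed_subset (isClosed_tsupport _)
        ((hf i).trans Metric.ball_subset_closedBall)
    have hprod := HasWeakGradient.mul hχ (hum.locallyIntegrable (by norm_num))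
      (hGm.locallyIntegrable (by norm_num)) huG
    have hm1 : MemLp (fun x => f i x * u x) 2 volume := hum.smul (hχ.memLp ∞)
    have hm2 : MemLp (fun x => f i x • G x + u x • ∇ (f i) x) 2 volume :=
      (hGm.smul (hχ.memLp ∞)).add ((hχ.memLp_gradient ∞).smul hum)
    refine ⟨_, toLp_mem_H10 hm1 hm2 fun ε hε => ?_, hm1.coeFn_toLp⟩
    have hK : IsCompact (tsupport (f i) ∩ closure Ω) :=
      hχ.hasCompactSupport.isCompact.inter_right isClosed_closure
    refine exists_testFunction_approx hΩo hK hm1 hm2 hprod ?_ (fun δ hδ => ?_) hε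
    · filter_upwards [hu] with x hx hxK
      by_cases hxΩ : x ∈ Ω
      · rw [image_eq_zero_of_notMem_tsupport fun h => hxK ⟨h, subset_closure hxΩ⟩, zero_mul]
      · rw [hx hxΩ, mul_zero]
    · obtain ⟨v, hvδ, hvΩ⟩ := hv i i.2 δ hδ
      exact ⟨v, hvδ, fun x hx => hvΩ x ⟨hf i hx.1, hx.2⟩⟩
  have hsum : ∀ T : Finset (closure Ω), ∃ p ∈ H10 Ω, p.fst =ᵐ[volume]
      fun x => (∑ i ∈ T, f i x) * u x := by
    intro T
    induction T using Finset.cons_induction with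
    | empty =>
      refine ⟨0, zero_mem _, (Lp.coeFn_zero _ _ _).trans (.of_eq ?_)⟩
      ext x
      simp
    | cons i T hi ih =>
      obtain ⟨p, hp, hpe⟩ := ih
      obtain ⟨q, hq, hqe⟩ := hpiece i
      refine ⟨q + p, add_mem hq hp, (Lp.coeFn_add q.fst p.fst).trans ?_⟩
      filter_upwards [hpe, hqe] with x h1 h2
      rw [Pi.add_apply, h1, h2, Finset.sum_cons, add_mul]
  obtain ⟨p, hp, hpe⟩ := hsum hfin.toFinset
  have hpu : p.fst = u := by
    refine Lp.ext ?_
    filter_upwards [hpe, hu] with x h1 h2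
    rw [h1]
    by_cases hxΩ : x ∈ Ω
    · have h3 := f.sum_eq_one (subset_closure hxΩ)
      rw [finsum_eq_sum_of_support_subset] at h3
      · rw [h3, one_mul]
      · intro i hi
        simpa using ⟨x, hi, subset_closure hxΩ⟩
    · rw [h2 hxΩ, mul_zero]
  -- By uniqueness of the weak gradient, the terms with `∇ (f i)` need not be summed explicitly.
  have hpG : p.snd = G := (hpu ▸ isWeakGradient_of_mem_H10 hp).eq huG
  rw [← hpu, ← hpG]
  exact hp

/-! ### The estimate for translations and the Poincaré inequality -/

/-- The estimate for translations of test functions passes to their limits. -/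
theorem eLpNorm_translate_sub_le {Ω : Set (E N)} {p : L2Pair N} (hp : p ∈ H10 Ω) (h : E N) :
    eLpNorm (fun x => p.fst (x + h) - p.fst x) 2 volume ≤ ‖h‖ₑ * ‖p.snd‖ₑ := by
  have hmp : MeasurePreserving (fun x : E N => x + h) volume volume :=
    measurePreserving_add_right _ _
  have hT : ∀ u : L2Space N, eLpNorm (fun x => u (x + h) - u x) 2 volume =
      edist (Lp.compMeasurePreserving _ hmp u) u := by
    intro u
    rw [Lp.edist_def]
    refine eLpNorm_congr_ae ?_
    filter_upwards [Lp.coeFn_compMeasurePreserving u hmp] with x hx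
    rw [Pi.sub_apply, hx, Function.comp_apply]
  rw [hT, edist_dist, ← ofReal_norm, ← ofReal_norm,
    ← ENNReal.ofReal_mul (norm_nonneg _)]
  refine ENNReal.ofReal_le_ofReal ?_
  refine H10.closed_induction
    (P := fun p => dist (Lp.compMeasurePreserving _ hmp p.fst) p.fst ≤ ‖h‖ * ‖p.snd‖)
    ?_ (fun q φ hφ h1 h2 => ?_) hp
  · have hc1 := WithLp.continuous_fst 2 (L2Space N) (L2Field N)
    have hc2 := WithLp.continuous_snd 2 (L2Space N) (L2Field N)
    exact isClosed_le (((Lp.isometry_compMeasurePreserving hmp).continuous.comp hc1).dist hc1)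
      (continuous_const.mul hc2.norm)
  · rw [← ENNReal.ofReal_le_ofReal_iff (by positivity), ENNReal.ofReal_mul (norm_nonneg _),
      ofReal_norm, ofReal_norm, ← edist_dist, ← hT, Lp.enorm_def,
      eLpNorm_congr_ae h2]
    refine le_trans (le_of_eq ?_)
      (eLpNorm_translate_sub_le_of_contDiff (hφ.smooth.of_le (by simp)) h)
    refine eLpNorm_congr_ae ?_
    filter_upwards [h1, hmp.quasiMeasurePreserving.ae h1] with x hx hx'
    rw [hx, hx']

/-- The **Poincaré inequality**. A translation by more than the diameter of `Ω` separates the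
supports of a function and of its translate, so that their difference is at least as large as the
function. -/
theorem exists_poincare [NeZero N] {Ω : Set (E N)} (hΩo : IsOpen Ω)
    (hΩb : Bornology.IsBounded Ω) :
    ∃ C : ℝ, 0 < C ∧ ∀ p ∈ H10 Ω, ‖p.fst‖ ≤ C * ‖p.snd‖ := by
  obtain ⟨R, hR, hΩR⟩ := hΩb.exists_pos_norm_lt
  refine ⟨2 * R, by positivity, fun p hp => ?_⟩
  set h : E N := EuclideanSpace.single 0 (2 * R) with hh
  have hhn : ‖h‖ = 2 * R := by
    rw [hh, PiLp.norm_single, Real.norm_of_nonneg (by positivity)]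
  have hmp : MeasurePreserving (fun x : E N => x + h) volume volume :=
    measurePreserving_add_right _ _
  have h0 := ae_eq_zero_of_mem_H10 hΩo.measurableSet hp
  have hle : ‖p.fst‖ₑ ≤ ‖h‖ₑ * ‖p.snd‖ₑ := by
    refine le_trans ?_ (eLpNorm_translate_sub_le hp h)
    rw [Lp.enorm_def]
    refine eLpNorm_mono_ae ?_
    filter_upwards [h0, hmp.quasiMeasurePreserving.ae h0] with x hx hx'
    by_cases hxΩ : x ∈ Ω
    · have hxh : x + h ∉ Ω := by
        intro hcon
        have h1 := norm_sub_le (x + h) x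
        rw [add_sub_cancel_left, hhn] at h1
        have h2 := hΩR _ hxΩ
        have h3 := hΩR _ hcon
        linarith
      rw [hx' hxh]
      simp
    · rw [hx hxΩ]
      simp
  rwa [← hhn, ← ENNReal.ofReal_le_ofReal_iff (by positivity), ENNReal.ofReal_mul (norm_nonneg _),
      ofReal_norm, ofReal_norm, ofReal_norm]

/-! ### The embedding of `H^1_0(Ω)` into `H^s(ℝ^N)` -/

/-- The kernel `|h|^{-N-2s}` is integrable against `min(1, |h|)^2`, because of `s < 1` at the
origin and of `s > 0` at infinity. -/
theorem integrable_kernel [NeZero N] {s : ℝ} (hs0 : 0 < s) (hs1 : s < 1) :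
    Integrable (fun h : E N => min 1 ‖h‖ ^ 2 / ‖h‖ ^ ((N : ℝ) + 2 * s)) volume := by
  refine (integrable_fun_norm_addHaar (volume : Measure (E N))
    (f := fun r : ℝ => min 1 r ^ 2 / r ^ ((N : ℝ) + 2 * s))).2 ?_
  rw [finrank_euclideanSpace_fin]
  have hN : 1 ≤ N := NeZero.one_le
  have hpow : ∀ r : ℝ, 0 < r → r ^ (N - 1) = r ^ ((N : ℝ) - 1) := by
    intro r _
    rw [← Real.rpow_natCast, Nat.cast_sub hN, Nat.cast_one]
  rw [← Ioc_union_Ioi_eq_Ioi zero_le_one]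
  refine IntegrableOn.union ?_ ?_
  · have h1 : IntegrableOn (fun r : ℝ => r ^ (1 - 2 * s)) (Ioc 0 1) := by
      rw [← intervalIntegrable_iff_integrableOn_Ioc_of_le zero_le_one]
      exact intervalIntegral.intervalIntegrable_rpow' (by linarith)
    refine h1.congr_fun (fun r hr => ?_) measurableSet_Ioc
    have hr0 : 0 < r := hr.1
    simp only [smul_eq_mul]
    rw [min_eq_right hr.2, hpow r hr0, ← Real.rpow_natCast r 2, ← Real.rpow_sub hr0,
      ← Real.rpow_add hr0]
    congr 1
    push_cast
    ring
  · refine (integrableOn_Ioi_rpow_of_lt (a := -1 - 2 * s) (by linarith) zero_lt_one).congr_fun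
      (fun r hr => ?_) measurableSet_Ioi
    have hr1 : 1 < r := hr
    have hr0 : 0 < r := by linarith
    simp only [smul_eq_mul]
    rw [min_eq_left hr1.le, hpow r hr0, one_pow, one_div, ← Real.rpow_neg hr0.le,
      ← Real.rpow_add hr0]
    congr 1
    ring

/-- The fractional difference quotient `(u(x) - u(y)) / |x - y|^{(N + 2s)/2}`, the square of whose
norm in `L^2(ℝ^N × ℝ^N)` is the Gagliardo seminorm of `u` in `H^s(ℝ^N)`, squared. -/
def fracQuotient (s : ℝ) (u : E N → ℝ) (z : E N × E N) : ℝ :=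
  (u z.1 - u z.2) / ‖z.1 - z.2‖ ^ (((N : ℝ) + 2 * s) / 2)

theorem fracQuotient_congr (s : ℝ) {u v : E N → ℝ} (h : u =ᵐ[volume] v) :
    fracQuotient s u =ᵐ[volume] fracQuotient s v := by
  have h1 : ∀ᵐ z : E N × E N, u z.1 = v z.1 := Measure.quasiMeasurePreserving_fst.ae h
  have h2 : ∀ᵐ z : E N × E N, u z.2 = v z.2 := Measure.quasiMeasurePreserving_snd.ae h
  filter_upwards [h1, h2] with z hz1 hz2
  rw [fracQuotient, fracQuotient, hz1, hz2]

theorem aestronglyMeasurable_fracQuotient (s : ℝ) {u : E N → ℝ}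
    (hu : AEStronglyMeasurable u volume) : AEStronglyMeasurable (fracQuotient s u) volume := by
  refine AEStronglyMeasurable.div₀ (hu.comp_fst.sub hu.comp_snd) ?_
  have : Measurable fun z : E N × E N => ‖z.1 - z.2‖ ^ (((N : ℝ) + 2 * s) / 2) := by fun_prop
  exact this.aestronglyMeasurable

/-- The bound for the Gagliardo seminorm: in the variables `x` and `h = y - x`, the integral over
`x` is controlled by the effect of the translation by `h`. -/
theorem eLpNorm_fracQuotient_sq_le (s : ℝ) {u : E N → ℝ} (hu : MemLp u 2 volume) {M : ℝ≥0∞}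
    (hM : ∀ h : E N, eLpNorm (fun x => u (x + h) - u x) 2 volume ≤ ‖h‖ₑ * M) :
    eLpNorm (fracQuotient s u) 2 volume ^ 2 ≤
      (∫⁻ h : E N, ‖min 1 ‖h‖ ^ 2 / ‖h‖ ^ ((N : ℝ) + 2 * s)‖ₑ) *
        (2 * eLpNorm u 2 volume + M) ^ 2 := by
  set A := 2 * eLpNorm u 2 volume + M with hA
  have hmp : MeasurePreserving (fun z : E N × E N => (z.1, z.1 + z.2)) volume volume :=
    measurePreserving_prod_add volume volume
  -- For `|h| ≥ 1` the triangle inequality is used, for `|h| ≤ 1` the hypothesis.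
  have hmin : ∀ h : E N, eLpNorm (fun x => u (x + h) - u x) 2 volume ≤ ‖min 1 ‖h‖‖ₑ * A := by
    intro h
    rcases le_total 1 ‖h‖ with h1 | h1
    · rw [min_eq_left h1]
      have hmph : MeasurePreserving (fun x : E N => x + h) volume volume :=
        measurePreserving_add_right _ _
      have h2 : eLpNorm (fun x => u (x + h) - u x) 2 volume ≤ _ :=
        eLpNorm_sub_le (hu.comp_measurePreserving hmph).aestronglyMeasurable
          hu.aestronglyMeasurable (by norm_num)
      rw [show eLpNorm (fun x => u (x + h)) 2 volume = eLpNorm u 2 volume from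
        eLpNorm_comp_measurePreserving hu.aestronglyMeasurable hmph, ← two_mul] at h2
      refine h2.trans ?_
      rw [enorm_one, one_mul]
      exact le_self_add
    · rw [min_eq_right h1, enorm_norm]
      refine (hM h).trans ?_
      gcongr
      exact le_add_self
  have hmeas := aestronglyMeasurable_fracQuotient s hu.aestronglyMeasurable
  have hcomp := hmeas.comp_measurePreserving hmp
  rw [← eLpNorm_comp_measurePreserving hmeas hmp, eLpNorm_two_sq, Measure.volume_eq_prod,
    lintegral_prod_symm _ (hcomp.enorm.pow_const 2), ← lintegral_mul_const _ (by fun_prop)]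
  refine lintegral_mono fun h => ?_
  set c : ℝ := ‖h‖ ^ ((N : ℝ) + 2 * s) with hc
  have hc2 : (‖h‖ ^ (((N : ℝ) + 2 * s) / 2)) ^ 2 = c := by
    rw [hc, ← Real.rpow_natCast, ← Real.rpow_mul (norm_nonneg _)]
    congr 1
    push_cast
    ring
  have hpt : ∀ x, ‖(fracQuotient s u ∘ fun z : E N × E N => (z.1, z.1 + z.2)) (x, h)‖ₑ ^ 2 =
      ‖u (x + h) - u x‖ₑ ^ 2 * ‖c⁻¹‖ₑ := by
    intro x
    simp only [Function.comp_apply, fracQuotient, sub_add_cancel_left, norm_neg]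
    rw [← enorm_pow, ← enorm_pow, ← enorm_mul, div_pow, hc2, div_eq_mul_inv, sub_sq_comm]
  simp only [hpt]
  rw [lintegral_mul_const' _ _ enorm_ne_top, ← eLpNorm_two_sq]
  refine (mul_le_mul_left (pow_le_pow_left' (hmin h) 2) _).trans (le_of_eq ?_)
  rw [div_eq_mul_inv, enorm_mul, enorm_pow, mul_pow]
  ring

/-- A function of `H^1_0(Ω)` has a fractional difference quotient in `L^2`, bounded by its norm. -/
theorem exists_eLpNorm_fracQuotient_le [NeZero N] {s : ℝ} (hs0 : 0 < s) (hs1 : s < 1) :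
    ∃ C : ℝ, 0 ≤ C ∧ ∀ (Ω : Set (E N)), ∀ p ∈ H10 Ω,
      eLpNorm (fracQuotient s p.fst) 2 volume ≤ ENNReal.ofReal (C * ‖p‖) := by
  set K := ∫⁻ h : E N, ‖min 1 ‖h‖ ^ 2 / ‖h‖ ^ ((N : ℝ) + 2 * s)‖ₑ with hK
  have hKfin : K ≠ ⊤ := (integrable_kernel hs0 hs1).2.ne
  refine ⟨√K.toReal * 3, by positivity, fun Ω p hp => ?_⟩
  have h := eLpNorm_fracQuotient_sq_le s (Lp.memLp p.fst) (M := ‖p.snd‖ₑ)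
    (eLpNorm_translate_sub_le hp)
  rw [← hK] at h
  have h1 : ‖p.fst‖ ≤ ‖p‖ := by
    refine abs_le_of_sq_le_sq' ?_ (norm_nonneg _) |>.2
    rw [WithLp.prod_norm_sq_eq_of_L2]
    nlinarith [norm_nonneg p.snd]
  have h2 : ‖p.snd‖ ≤ ‖p‖ := by
    refine abs_le_of_sq_le_sq' ?_ (norm_nonneg _) |>.2
    rw [WithLp.prod_norm_sq_eq_of_L2]
    nlinarith [norm_nonneg p.fst]
  rw [← ENNReal.pow_le_pow_left_iff two_ne_zero]
  refine h.trans ?_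
  rw [mul_assoc, ENNReal.ofReal_mul (by positivity), mul_pow, ← ENNReal.ofReal_pow (by positivity),
    Real.sq_sqrt ENNReal.toReal_nonneg, ENNReal.ofReal_toReal hKfin]
  gcongr
  rw [← Lp.enorm_def, ← ofReal_norm, ← ofReal_norm,
    two_mul, ← ENNReal.ofReal_add (by positivity) (by positivity),
    ← ENNReal.ofReal_add (by positivity) (by positivity)]
  exact ENNReal.ofReal_le_ofReal (by linarith)

/-! ### The bilinear form on `H^1_0(Ω)` -/

/-- The nonlocal part of the form enters coercivity only through this sign, which makes it
nonnegative on the diagonal. -/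
theorem fracConst_nonneg (N : ℕ) [NeZero N] (s : ℝ) : 0 ≤ fracConst N s := by
  refine inv_nonneg.2 (integral_nonneg fun ζ => ?_)
  exact div_nonneg (sub_nonneg.2 (Real.cos_le_one _)) (by positivity)

/-- The fractional difference quotient as a bounded operator from `H^1_0(Ω)` to
`L^2(ℝ^N × ℝ^N)`. -/
theorem exists_fracQuotientCLM [NeZero N] {s : ℝ} (hs0 : 0 < s) (hs1 : s < 1) (Ω : Set (E N)) :
    ∃ D : H10 Ω →L[ℝ] Lp ℝ 2 (volume : Measure (E N × E N)),
      ∀ p : H10 Ω, D p =ᵐ[volume] fracQuotient s (p : L2Pair N).fst := by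
  obtain ⟨C, hC, hle⟩ := exists_eLpNorm_fracQuotient_le (N := N) hs0 hs1
  have hmem : ∀ p : H10 Ω, MemLp (fracQuotient s (p : L2Pair N).fst) 2 volume := fun p =>
    ⟨aestronglyMeasurable_fracQuotient s (Lp.memLp _).aestronglyMeasurable,
      (hle Ω p p.2).trans_lt ENNReal.ofReal_lt_top⟩
  let D₀ : H10 Ω →ₗ[ℝ] Lp ℝ 2 (volume : Measure (E N × E N)) :=
    { toFun := fun p => (hmem p).toLp _
      map_add' := fun p q => by
        rw [← MemLp.toLp_add]
        refine MemLp.toLp_congr _ _ ?_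
        refine (fracQuotient_congr s (Lp.coeFn_add (p : L2Pair N).fst (q : L2Pair N).fst)).trans
          (.of_eq ?_)
        ext z
        simp only [fracQuotient, Pi.add_apply]
        ring
      map_smul' := fun c p => by
        rw [RingHom.id_apply, ← MemLp.toLp_const_smul]
        refine MemLp.toLp_congr _ _ ?_
        refine (fracQuotient_congr s (Lp.coeFn_smul c (p : L2Pair N).fst)).trans (.of_eq ?_)
        ext z
        simp only [fracQuotient, Pi.smul_apply, smul_eq_mul]
        ring }
  refine ⟨D₀.mkContinuous C fun p => ?_, fun p => (hmem p).coeFn_toLp⟩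
  rw [← ENNReal.ofReal_le_ofReal_iff (by positivity), ofReal_norm]
  exact (Lp.enorm_toLp (hmem p)).trans_le (hle Ω p p.2)

/-- The bilinear form of `-Δ + (-Δ)^s` on `H^1_0(Ω)`: it is continuous, it controls the norm of
the gradient, and it extends `mixedForm`. -/
theorem exists_bilinForm [NeZero N] {s : ℝ} (hs0 : 0 < s) (hs1 : s < 1) (Ω : Set (E N)) :
    ∃ B : H10 Ω →L[ℝ] H10 Ω →L[ℝ] ℝ, (∀ p : H10 Ω, ‖(p : L2Pair N).snd‖ ^ 2 ≤ B p p) ∧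
      ∀ (p : H10 Ω) (φ : E N → ℝ) (hφ : IsTestFunction Ω φ),
        B p ⟨hφ.toPair, hφ.toPair_mem⟩ = mixedForm s Ω (p : L2Pair N).fst φ := by
  obtain ⟨D, hD⟩ := exists_fracQuotientCLM hs0 hs1 Ω
  let g : H10 Ω →L[ℝ] L2Field N := (WithLp.sndL 2 ℝ (L2Space N) (L2Field N)).comp (H10 Ω).subtypeL
  let I₁ : L2Field N →L[ℝ] L2Field N →L[ℝ] ℝ := innerSL ℝ
  let I₂ : Lp ℝ 2 (volume : Measure (E N × E N)) →L[ℝ]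
    Lp ℝ 2 (volume : Measure (E N × E N)) →L[ℝ] ℝ := innerSL ℝ
  have hB : ∀ p q : H10 Ω, (I₁.bilinearComp g g + (fracConst N s / 2) • I₂.bilinearComp D D) p q =
      inner ℝ (p : L2Pair N).snd (q : L2Pair N).snd + fracConst N s / 2 * inner ℝ (D p) (D q) :=
    fun p q => rfl
  refine ⟨I₁.bilinearComp g g + (fracConst N s / 2) • I₂.bilinearComp D D, fun p => ?_,
    fun p φ hφ => ?_⟩
  · rw [hB, real_inner_self_eq_norm_sq, real_inner_self_eq_norm_sq]
    have := fracConst_nonneg N s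
    have h : 0 ≤ fracConst N s / 2 * ‖D p‖ ^ 2 := by positivity
    linarith
  · have hw : weakGrad (p : L2Pair N).fst = (p : L2Pair N).snd := by
      have h := isWeakGradient_of_mem_H10 p.2
      exact (isWeakGradient_weakGrad ⟨_, h⟩).eq h
    have h1 : inner ℝ (p : L2Pair N).snd hφ.toPair.snd =
        ∫ x in Ω, inner ℝ ((p : L2Pair N).snd x) (∇ φ x) := by
      rw [L2.inner_def, setIntegral_eq_integral_of_forall_compl_eq_zero]
      · refine integral_congr_ae ?_
        filter_upwards [hφ.toPair_snd] with x hx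
        rw [hx]
      · intro x hx
        have h0 : ∇ φ x = 0 := image_eq_zero_of_notMem_tsupport fun h =>
          hx (hφ.tsupport_subset (tsupport_gradient_subset φ h))
        rw [h0, inner_zero_right]
    have h2 : inner ℝ (D p) (D ⟨hφ.toPair, hφ.toPair_mem⟩) =
        ∫ z : E N × E N, ((p : L2Pair N).fst z.1 - (p : L2Pair N).fst z.2) * (φ z.1 - φ z.2) /
          ‖z.1 - z.2‖ ^ ((N : ℝ) + 2 * s) := by
      rw [L2.inner_def]
      refine integral_congr_ae ?_
      filter_upwards [hD p, (hD ⟨hφ.toPair, hφ.toPair_mem⟩).trans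
        (fracQuotient_congr s hφ.toPair_fst)] with z h1 h2
      have h3 : ‖z.1 - z.2‖ ^ ((N : ℝ) + 2 * s) = ‖z.1 - z.2‖ ^ (((N : ℝ) + 2 * s) / 2) *
          ‖z.1 - z.2‖ ^ (((N : ℝ) + 2 * s) / 2) := by
        rw [← Real.rpow_add_of_nonneg (norm_nonneg _) (by positivity) (by positivity), add_halves]
      rw [h1, h2, h3, RCLike.inner_apply, conj_trivial, mul_comm]
      simp only [fracQuotient]
      rw [div_mul_div_comm]
    rw [hB, mixedForm, hw, h1, h2]

/-- The functional `v ↦ ∫_Ω f v` on `H^1_0(Ω)`. -/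
theorem exists_functional {Ω : Set (E N)} (f : L2 Ω) :
    ∃ F : H10 Ω →L[ℝ] ℝ, (∀ p : H10 Ω, |F p| ≤ ‖f‖ * ‖(p : L2Pair N).fst‖) ∧
      ∀ (φ : E N → ℝ) (hφ : IsTestFunction Ω φ),
        F ⟨hφ.toPair, hφ.toPair_mem⟩ = ∫ x in Ω, f x * φ x := by
  set R := LpToLpRestrictCLM (E N) ℝ ℝ volume 2 Ω with hR
  have hRn : ∀ u : L2Space N, ‖R u‖ ≤ ‖u‖ := fun u => norm_Lp_toLp_restrict_le Ω u
  let r : H10 Ω →L[ℝ] L2 Ω :=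
    R.comp ((WithLp.fstL 2 ℝ (L2Space N) (L2Field N)).comp (H10 Ω).subtypeL)
  refine ⟨(innerSL ℝ f).comp r, fun p => ?_, fun φ hφ => ?_⟩
  · exact (abs_real_inner_le_norm f (r p)).trans (by gcongr; exact hRn _)
  · change inner ℝ f (R hφ.toPair.fst) = _
    rw [L2.inner_def]
    refine integral_congr_ae ?_
    filter_upwards [LpToLpRestrictCLM_coeFn ℝ (μ := volume) Ω hφ.toPair.fst,
      ae_restrict_of_ae hφ.toPair_fst] with x h1 h2
    rw [hR, h1, h2]
    simp [mul_comm]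

/-- Two continuous functionals on `H^1_0(Ω)` that agree on test functions are equal. -/
theorem H10.ext_continuousLinearMap {Ω : Set (E N)} {F F' : H10 Ω →L[ℝ] ℝ}
    (h : ∀ (φ : E N → ℝ) (hφ : IsTestFunction Ω φ),
      F ⟨hφ.toPair, hφ.toPair_mem⟩ = F' ⟨hφ.toPair, hφ.toPair_mem⟩) : F = F' := by
  have hd : DenseRange (Set.inclusion (testPairs Ω).le_topologicalClosure) :=
    denseRange_inclusion_iff _ |>.2 subset_rfl
  refine DFunLike.coe_injective (hd.equalizer F.continuous F'.continuous ?_)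
  ext ⟨p, hp⟩
  obtain ⟨φ, hφ, h1, h2⟩ := hp
  have hpφ : p = hφ.toPair :=
    WithLp.ofLp_injective 2 (Prod.ext (Lp.ext (h1.trans hφ.toPair_fst.symm))
      (Lp.ext (h2.trans hφ.toPair_snd.symm)))
  subst hpφ
  exact h φ hφ

/-! ### Existence, uniqueness and the estimate -/

/-- On a bounded open set with `C^1` boundary, the weak solutions of the problem are the solutions
of the variational problem in `H^1_0(Ω)`. -/
theorem isWeakSolution_iff [NeZero N] {s : ℝ} {Ω : Set (E N)} (hΩo : IsOpen Ω)
    (hΩb : Bornology.IsBounded Ω) (hΩ : HasC1Boundary Ω) {B : H10 Ω →L[ℝ] H10 Ω →L[ℝ] ℝ}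
    (hB : ∀ (p : H10 Ω) (φ : E N → ℝ) (hφ : IsTestFunction Ω φ),
      B p ⟨hφ.toPair, hφ.toPair_mem⟩ = mixedForm s Ω (p : L2Pair N).fst φ)
    {f : L2 Ω} {F : H10 Ω →L[ℝ] ℝ}
    (hF : ∀ (φ : E N → ℝ) (hφ : IsTestFunction Ω φ),
      F ⟨hφ.toPair, hφ.toPair_mem⟩ = ∫ x in Ω, f x * φ x) (u : L2Space N) :
    IsWeakSolution s Ω f u ↔ ∃ p : H10 Ω, (p : L2Pair N).fst = u ∧ B p = F := by
  constructor
  · rintro ⟨⟨h1, heq⟩, -, h0⟩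
    refine ⟨⟨_, toLp_mem_H10_of_isWeakGradient hΩo hΩb hΩ (isWeakGradient_weakGrad h1) h0⟩, rfl,
      H10.ext_continuousLinearMap fun φ hφ => ?_⟩
    rw [hB, hF]
    exact heq φ hφ
  · rintro ⟨p, rfl, hp⟩
    have h1 : MemH1 (p : L2Pair N).fst := ⟨_, isWeakGradient_of_mem_H10 p.2⟩
    refine ⟨⟨h1, fun φ hφ => ?_⟩, h1, ae_eq_zero_of_mem_H10 hΩo.measurableSet p.2⟩
    rw [← hB p φ hφ, hp, hF]

end MixedOperator

end

open MixedOperator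

theorem theorem1p1 (N : ℕ) [NeZero N] (s : ℝ) (hs0 : 0 < s) (hs1 : s < 1)
    (Ω : Set (MixedOperator.E N)) (hΩo : IsOpen Ω) (hΩb : Bornology.IsBounded Ω)
    (hΩ : MixedOperator.HasC1Boundary Ω) :
    (∀ f : MixedOperator.L2 Ω, ∃! u : MixedOperator.L2Space N,
      MixedOperator.IsWeakSolution s Ω f u) ∧
    ∃ c : ℝ, 0 < c ∧ ∀ (f : MixedOperator.L2 Ω) (u : MixedOperator.L2Space N),
      MixedOperator.IsWeakSolution s Ω f u → MixedOperator.h1Norm u ≤ c * ‖f‖ := by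
  obtain ⟨B, hBpos, hB⟩ := exists_bilinForm hs0 hs1 Ω
  obtain ⟨C, hC, hP⟩ := exists_poincare hΩo hΩb
  have hiff := fun (f : L2 Ω) (F : H10 Ω →L[ℝ] ℝ) hF u =>
    isWeakSolution_iff (f := f) (F := F) hΩo hΩb hΩ hB hF u
  refine ⟨fun f => ?_, C ^ 2 + C, by positivity, fun f u hu => ?_⟩
  · obtain ⟨F, -, hF⟩ := exists_functional f
    have hcomplete : CompleteSpace (H10 Ω) :=
      (testPairs Ω).isClosed_topologicalClosure.completeSpace_coe
    have hcoercive : IsCoercive B := by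
      refine ⟨(C ^ 2 + 1)⁻¹, by positivity, fun p => ?_⟩
      have h1 := hP p p.2
      have h2 : ‖p‖ ^ 2 = ‖(p : L2Pair N).fst‖ ^ 2 + ‖(p : L2Pair N).snd‖ ^ 2 :=
        WithLp.prod_norm_sq_eq_of_L2 (p : L2Pair N)
      rw [mul_assoc, ← sq, inv_mul_le_iff₀ (by positivity), h2]
      have h3 := pow_le_pow_left₀ (norm_nonneg _) h1 2
      have h4 := mul_le_mul_of_nonneg_left (hBpos p) (by positivity : 0 ≤ C ^ 2 + 1)
      linarith
    let w := (InnerProductSpace.toDual ℝ (H10 Ω)).symm F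
    have hex : B (hcoercive.continuousLinearEquivOfBilin.symm w) = F := by
      ext q
      rw [← hcoercive.continuousLinearEquivOfBilin_apply,
        ContinuousLinearEquiv.apply_symm_apply, InnerProductSpace.toDual_symm_apply]
    refine ⟨_, (hiff f F hF _).2 ⟨_, rfl, hex⟩, fun v hv => ?_⟩
    obtain ⟨q, rfl, hq⟩ := (hiff f F hF v).1 hv
    obtain rfl : q = hcoercive.continuousLinearEquivOfBilin.symm w := by
      rw [ContinuousLinearEquiv.eq_symm_apply]
      refine ext_inner_right ℝ fun r => ?_
      rw [hcoercive.continuousLinearEquivOfBilin_apply, hq, InnerProductSpace.toDual_symm_apply]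
    rfl
  · obtain ⟨F, hFle, hF⟩ := exists_functional f
    obtain ⟨p, rfl, hp⟩ := (hiff f F hF u).1 hu
    have hG : weakGrad (p : L2Pair N).fst = (p : L2Pair N).snd :=
      (isWeakGradient_weakGrad hu.1.1).eq (isWeakGradient_of_mem_H10 p.2)
    have h1 := hP p p.2
    have h2 : ‖(p : L2Pair N).snd‖ ^ 2 ≤ ‖f‖ * (C * ‖(p : L2Pair N).snd‖) :=
      calc _ ≤ B p p := hBpos p
        _ = F p := by rw [hp]
        _ ≤ ‖f‖ * ‖(p : L2Pair N).fst‖ := (le_abs_self _).trans (hFle p)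
        _ ≤ _ := by gcongr
    have h3 : ‖(p : L2Pair N).snd‖ ≤ C * ‖f‖ := by
      rcases (norm_nonneg (p : L2Pair N).snd).eq_or_lt with h0 | h0
      · rw [← h0]
        positivity
      · refine le_of_mul_le_mul_right ?_ h0
        linarith
    rw [h1Norm, hG]
    have h4 : ‖(p : L2Pair N).fst‖ ≤ C ^ 2 * ‖f‖ := by
      refine h1.trans ?_
      rw [sq, mul_assoc]
      gcongr
    refine (Real.sqrt_le_left (by positivity)).2 ?_
    have := norm_nonneg (p : L2Pair N).fst
    have := norm_nonneg (p : L2Pair N).snd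
    nlinarith
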